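/- All rings are commutative with identity. A ring is *coherent* if each of its finitely generated ideals is finitely presented, and *quasi-local* if it has a unique maximal ideal. A *regular sequence* on an $R$-module $M$ is a finite (possibly empty) sequence $x_1,\dots,x_k$ in $R$ such that $x_i$ is a non-zero-divisor on $M/(x_1,\dots,x_{i-1})M$ for $1\le i\le k$ and $(x_1,\dots,x_k)M\neq M$. For a quasi-local ring $R$ with maximal ideal $\mathfrak m$, let $\operatorname{depth} R\in\mathbb N\cup\{\infty\}$ be the supremum, over all faithfully flat $R$-algebras $S$, of the lengths of regular sequences on $S$ contained in $\mathfrak mS$. Write $M^*=\operatorname{Hom}_R(M,R)$. A finitely generated $R$-module $M$ belongs to the *G-class* of $R$ if $\operatorname{Ext}^i_R(M,R)=0$ and $\operatorname{Ext}^i_R(M^*,R)=0$ for all $i>0$ and the natural map $M\to M^{**}$ is an isomorphism. A module $M$ has *finite G-dimension* if for some $k\ge 0$ there is an exact sequence $0\to G_k\to\cdots\to G_0\to M\to 0$ with every $G_i$ in the G-class of $R$. A quasi-local ring is *Gorenstein* if each of its finitely generated ideals has finite G-dimension. **Proposition.** Let $R$ be a quasi-local coherent Gorenstein ring with $\operatorname{depth}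 R=n<\infty$, and let $x_1,\dots,x_n$ be a regular sequence on $R$ of length $n$. Then the ideal $(x_1,\dots,x_n)$ is irreducible: it is a proper ideal, and whenever $(x_1,\dots,x_n)=J\cap K$ with ideals $J,K$ of $R$, then $J=(x_1,\dots,x_n)$ or $K=(x_1,\dots,x_n)$. -/

import Mathlib

namespace CohGor

open scoped TensorProduct

universe u v

/-- A commutative ring is coherent if every finitely generated ideal is finitely presented. -/
def IsCoherentRing (R : Type u) [CommRing R] : Prop :=
  ∀ I : Ideal R, I.FG → Module.FinitePresentation R I

/-- The classical depth of `M` with respect to `I`: the supremum of the lengths of the regular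
sequences on `M` that are contained in `I`. -/
noncomputable def classicalDepth {R : Type u} [CommRing R] (I : Ideal R)
    (M : Type v) [AddCommGroup M] [Module R M] : ℕ∞ :=
  ⨆ (xs : List R) (_ : RingTheory.Sequence.IsRegular M xs) (_ : ∀ x ∈ xs, x ∈ I),
    (xs.length : ℕ∞)

/-- The (non-Noetherian) depth of `M` with respect to `I`: the supremum of the classical depths of
`S ⊗[R] M` with respect to `IS`, over all faithfully flat extensions `S` of `R`. -/
noncomputable def depth {R : Type u} [CommRing R] (I : Ideal R)
    (M : Type v) [AddCommGroup M] [Module R M] : ℕ∞ :=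
  ⨆ (S : Type u) (_ : CommRing S) (_ : Algebra R S) (_ : Module.FaithfullyFlat R S),
    classicalDepth (I.map (algebraMap R S)) (S ⊗[R] M)

/-- The depth of a quasi-local ring: the depth of `R` with respect to its maximal ideal. -/
noncomputable def ringDepth (R : Type u) [CommRing R] [IsLocalRing R] : ℕ∞ :=
  depth (IsLocalRing.maximalIdeal R) R

/-- Membership in the G-class of `R`: finitely generated modules `M` such that
`Ext^i(M, R) = 0 = Ext^i(M^*, R)` for all `i > 0` and the natural map `M → M^**` is an
isomorphism. -/
structure IsGClass (R : Type u) [CommRing R] (M : Type u) [AddCommGroup M] [Module R M] :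
    Prop where
  finite : Module.Finite R M
  ext_eq_zero : ∀ i : ℕ, 0 < i →
    Subsingleton (CategoryTheory.Abelian.Ext.{u} (ModuleCat.of R M) (ModuleCat.of R R) i)
  ext_dual_eq_zero : ∀ i : ℕ, 0 < i →
    Subsingleton
      (CategoryTheory.Abelian.Ext.{u} (ModuleCat.of R (Module.Dual R M)) (ModuleCat.of R R) i)
  bijective_eval : Function.Bijective (Module.Dual.eval R M)

/-- A G-resolution of `M`: an exact sequence `⋯ → G 2 → G 1 → G 0 → M → 0` in which every `G i` is
in the G-class of `R`. -/
structure GResolution (R : Type u) [CommRing R] (M : Type u) [AddCommGroup M] [Module R M] where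
  G : ℕ → ModuleCat.{u} R
  d : ∀ i : ℕ, G (i + 1) →ₗ[R] G i
  aug : G 0 →ₗ[R] M
  isGClass : ∀ i : ℕ, IsGClass R (G i)
  aug_surjective : Function.Surjective aug
  exact_zero : Function.Exact (d 0) aug
  exact_succ : ∀ i : ℕ, Function.Exact (d (i + 1)) (d i)

/-- The length of a G-resolution: the supremum of the indices `n` with `G n ≠ 0`
(so it is `0` for the zero resolution). -/
noncomputable def GResolution.length {R : Type u} [CommRing R] {M : Type u} [AddCommGroup M]
    [Module R M] (P : GResolution R M) : ℕ∞ :=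
  ⨆ (n : ℕ) (_ : Nontrivial (P.G n)), (n : ℕ∞)

/-- The G-dimension of `M`: the infimum of the lengths of the G-resolutions of `M`.
It is `⊤` also if there is no G-resolution at all. -/
noncomputable def gDim (R : Type u) [CommRing R] (M : Type u) [AddCommGroup M] [Module R M] :
    ℕ∞ :=
  ⨅ P : GResolution R M, P.length

/-- A quasi-local ring is Gorenstein if every finitely generated ideal has finite G-dimension. -/
def IsGorensteinLocalRing (R : Type u) [CommRing R] [IsLocalRing R] : Prop :=
  ∀ I : Ideal R, I.FG → gDim R I < ⊤

end CohGor

/-! Let `L` be the ideal generated by the regular sequence. The claim says that zero is irreducible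
in `S = R/L`, and it follows once every `S/I` with `I` finitely generated satisfies `Ext^1(S/I, S) =
0`. Indeed, if nonzero principal ideals `J`, `K` met in zero, the projection of `J ⊕ K` onto `J`
would extend to multiplication by some `e` in `S`, acting as `1` on `J` and as `0` on `K`. Since `S`
is local, `e` or `1 - e` is a unit, a contradiction (`infIrred_bot_of_isTotRefl`).

Three facts give the vanishing. Finite G-dimension survives passage to the quotient by a
non-zero-divisor (`IsQuotientByRegular.gDimLE`, resting on Rees' change of rings for `Ext`), so each
`S/I` has finite G-dimension over `S`. Next, since the sequence has length equal to the depth, every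
finitely generated proper ideal of `R` is carried into `L` by some `z ∉ L`; otherwise a polynomial
whose coefficients generate the ideal would lengthen the sequence over the faithfully flat extension
`R[X]`, by McCoy's theorem (`exists_annihilator_of_depth`). Finally, over a coherent ring whose
finitely generated proper ideals have nonzero annihilators, finitely presented modules of finite
G-dimension are totally reflexive (`GDimLE.isTotRefl`). -/

namespace CohGor

open CategoryTheory

universe u

/-- `Ext^i_R(M, R) = 0`. -/
def ExtVanish (R : Type u) [CommRing R] (i : ℕ) (M : Type u) [AddCommGroup M] [Module R M] :
    Prop :=
  Subsingleton (Abelian.Ext.{u} (ModuleCat.of R M) (ModuleCat.of R R) i)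

/-! ### Vanishing of `Ext` along short exact sequences -/

section Ext

variable {R : Type u} [CommRing R] {A B C : Type u} [AddCommGroup A] [Module R A]
  [AddCommGroup B] [Module R B] [AddCommGroup C] [Module R C]

theorem ExtVanish.of_projective (P : Type u) [AddCommGroup P] [Module R P] [Module.Projective R P]
    {i : ℕ} (hi : 0 < i) : ExtVanish R i P := by
  obtain ⟨j, rfl⟩ := Nat.exists_eq_succ_of_ne_zero hi.ne'
  have : Projective (ModuleCat.of R P) := inferInstance
  exact Abelian.Ext.subsingleton_of_projective _ _ _

/-- The short complex of modules given by two composable linear maps which form an exact pair. -/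
abbrev shortComplexOfExact (f : A →ₗ[R] B) (g : B →ₗ[R] C) (h : Function.Exact f g) :
    ShortComplex (ModuleCat.{u} R) :=
  ShortComplex.mk (ModuleCat.ofHom f) (ModuleCat.ofHom g) (by
    ext x; simpa using h.apply_apply_eq_zero x)

theorem shortExact_of_exact {f : A →ₗ[R] B} {g : B →ₗ[R] C} (hf : Function.Injective f)
    (h : Function.Exact f g) (hg : Function.Surjective g) :
    (shortComplexOfExact f g h).ShortExact where
  exact := (ShortComplex.ShortExact.moduleCat_exact_iff_function_exact _).mpr h
  mono_f := (ModuleCat.mono_iff_injective _).mpr hf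
  epi_g := (ModuleCat.epi_iff_surjective _).mpr hg

theorem ExtVanish.left {f : A →ₗ[R] B} {g : B →ₗ[R] C} (hf : Function.Injective f)
    (h : Function.Exact f g) (hg : Function.Surjective g) {i : ℕ} (hB : ExtVanish R i B)
    (hC : ExtVanish R (i + 1) C) : ExtVanish R i A := by
  have hS := shortExact_of_exact hf h hg
  refine subsingleton_of_forall_eq 0 fun x => ?_
  obtain ⟨y, rfl⟩ := Abelian.Ext.contravariant_sequence_exact₁ hS _ x (add_comm 1 i)
    (hC.elim _ _)
  rw [hB.elim y 0, Abelian.Ext.comp_zero]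

theorem ExtVanish.middle {f : A →ₗ[R] B} {g : B →ₗ[R] C} (hf : Function.Injective f)
    (h : Function.Exact f g) (hg : Function.Surjective g) {i : ℕ} (hA : ExtVanish R i A)
    (hC : ExtVanish R i C) : ExtVanish R i B := by
  have hS := shortExact_of_exact hf h hg
  refine subsingleton_of_forall_eq 0 fun x => ?_
  obtain ⟨y, rfl⟩ := Abelian.Ext.contravariant_sequence_exact₂ hS _ x (hA.elim _ _)
  rw [hC.elim y 0, Abelian.Ext.comp_zero]

theorem ExtVanish.right {f : A →ₗ[R] B} {g : B →ₗ[R] C} (hf : Function.Injective f)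
    (h : Function.Exact f g) (hg : Function.Surjective g) {i : ℕ} (hA : ExtVanish R i A)
    (hB : ExtVanish R (i + 1) B) : ExtVanish R (i + 1) C := by
  have hS := shortExact_of_exact hf h hg
  refine subsingleton_of_forall_eq 0 fun x => ?_
  obtain ⟨y, rfl⟩ := Abelian.Ext.contravariant_sequence_exact₃ hS _ x (hB.elim _ _)
    (add_comm 1 i)
  rw [hA.elim y 0, Abelian.Ext.comp_zero]

theorem ExtVanish.exists_extend {f : A →ₗ[R] B} {g : B →ₗ[R] C} (hf : Function.Injective f)
    (h : Function.Exact f g) (hg : Function.Surjective g) (hC : ExtVanish R 1 C)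
    (φ : A →ₗ[R] R) : ∃ ψ : B →ₗ[R] R, ψ ∘ₗ f = φ := by
  have hS := shortExact_of_exact hf h hg
  obtain ⟨y, hy⟩ := Abelian.Ext.contravariant_sequence_exact₁ hS (ModuleCat.of R R)
    (Abelian.Ext.mk₀ (ModuleCat.ofHom φ)) (add_zero 1) (hC.elim _ _)
  obtain ⟨ψ, rfl⟩ := (Abelian.Ext.mk₀_bijective _ _).2 y
  rw [Abelian.Ext.mk₀_comp_mk₀] at hy
  have := (Abelian.Ext.mk₀_bijective _ _).1 hy
  refine ⟨ψ.hom, ?_⟩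
  ext x
  simpa using congrArg (fun t => t.hom x) this

/-- As `Ext^1(B, R) = 0`, every class in `Ext^1(C, R)` is the connecting image of a functional on
`A`, and the connecting map kills functionals that extend to `B`. -/
theorem ExtVanish.one_of_extend {f : A →ₗ[R] B} {g : B →ₗ[R] C} (hf : Function.Injective f)
    (h : Function.Exact f g) (hg : Function.Surjective g) (hB : ExtVanish R 1 B)
    (hext : ∀ φ : A →ₗ[R] R, ∃ ψ : B →ₗ[R] R, ψ ∘ₗ f = φ) : ExtVanish R 1 C := by
  have hS := shortExact_of_exact hf h hg
  refine subsingleton_of_forall_eq 0 fun x => ?_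
  obtain ⟨y, rfl⟩ := Abelian.Ext.contravariant_sequence_exact₃ hS _ x (hB.elim _ _) (add_zero 1)
  obtain ⟨φ, rfl⟩ := (Abelian.Ext.mk₀_bijective _ _).2 y
  obtain ⟨ψ, hψ⟩ := hext φ.hom
  have : φ = (shortComplexOfExact f g h).f ≫ ModuleCat.ofHom ψ := by
    ext x
    simp [← hψ]
  rw [this, ← Abelian.Ext.mk₀_comp_mk₀]
  exact hS.extClass_comp_assoc _

end Ext

/-! ### Factoring through surjections; left exactness of the dual -/

section Factor

variable {R A B C D : Type*} [CommRing R] [AddCommGroup A] [Module R A] [AddCommGroup B]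
  [Module R B] [AddCommGroup C] [Module R C] [AddCommGroup D] [Module R D]

theorem exists_factor_of_surjective {g : B →ₗ[R] C} (hg : Function.Surjective g)
    (φ : B →ₗ[R] D) (hφ : ∀ b, g b = 0 → φ b = 0) : ∃ ψ : C →ₗ[R] D, ψ ∘ₗ g = φ := by
  refine ⟨((LinearMap.ker g).liftQ φ hφ) ∘ₗ (g.quotKerEquivOfSurjective hg).symm, ?_⟩
  ext b
  have : (g.quotKerEquivOfSurjective hg).symm (g b) = (LinearMap.ker g).mkQ b := by
    rw [LinearEquiv.symm_apply_eq]; rfl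
  rw [LinearMap.comp_apply, LinearMap.comp_apply, LinearEquiv.coe_coe, this]
  exact Submodule.liftQ_apply _ _ _

theorem exists_factor_of_exact {f : A →ₗ[R] B} {g : B →ₗ[R] C} (h : Function.Exact f g)
    (hg : Function.Surjective g) (φ : B →ₗ[R] D) (hφ : φ ∘ₗ f = 0) :
    ∃ ψ : C →ₗ[R] D, ψ ∘ₗ g = φ := by
  refine exists_factor_of_surjective hg φ fun b hb => ?_
  obtain ⟨a, rfl⟩ := (h b).1 hb
  exact LinearMap.congr_fun hφ a

theorem exact_dualMap {f : A →ₗ[R] B} {g : B →ₗ[R] C}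
    (h : Function.Exact f g) (hg : Function.Surjective g) :
    Function.Exact g.dualMap f.dualMap := by
  refine fun φ => ⟨fun hφ => exists_factor_of_exact h hg φ hφ, ?_⟩
  rintro ⟨ψ, rfl⟩
  ext a
  simp [h.apply_apply_eq_zero]

end Factor

/-- `M` is totally reflexive: `Ext^i(M, R) = 0 = Ext^i(M^*, R)` for `i > 0` and `M → M^**` is
bijective. No finiteness is imposed. -/
structure IsTotRefl (R : Type u) [CommRing R] (M : Type u) [AddCommGroup M] [Module R M] :
    Prop where
  ext : ∀ i, 0 < i → ExtVanish R i M
  ext_dual : ∀ i, 0 < i → ExtVanish R i (Module.Dual R M)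
  bijective_eval : Function.Bijective (Module.Dual.eval R M)

/-! ### Totally reflexive modules in short exact sequences -/

section TotRefl

variable {R : Type u} [CommRing R] {A B C : Type u} [AddCommGroup A] [Module R A]
  [AddCommGroup B] [Module R B] [AddCommGroup C] [Module R C]

theorem IsGClass.isTotRefl {M : Type u} [AddCommGroup M] [Module R M] (h : IsGClass R M) :
    IsTotRefl R M := ⟨h.ext_eq_zero, h.ext_dual_eq_zero, h.bijective_eval⟩

theorem IsTotRefl.of_free (F : Type u) [AddCommGroup F] [Module R F] [Module.Free R F]
    [Module.Finite R F] : IsTotRefl R F :=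
  ⟨fun _ hi => .of_projective F hi, fun _ hi => .of_projective _ hi,
    Module.bijective_dual_eval R F⟩

/-- The kernel of a surjection of totally reflexive modules is totally reflexive. -/
theorem IsTotRefl.left {f : A →ₗ[R] B} {g : B →ₗ[R] C} (hf : Function.Injective f)
    (h : Function.Exact f g) (hg : Function.Surjective g) (hB : IsTotRefl R B)
    (hC : IsTotRefl R C) : IsTotRefl R A := by
  have hfs : Function.Surjective f.dualMap := fun φ =>
    ExtVanish.exists_extend hf h hg (hC.ext 1 one_pos) φ
  have hgi : Function.Injective g.dualMap := LinearMap.dualMap_injective_of_surjective hg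
  have hex := exact_dualMap h hg
  refine ⟨fun i hi => .left hf h hg (hB.ext i hi) (hC.ext _ (by omega)), fun i hi => ?_, ?_, ?_⟩
  · obtain rfl | ⟨j, rfl⟩ : i = 1 ∨ ∃ j, i = j + 1 + 1 := by
      obtain ⟨j, rfl⟩ := Nat.exists_eq_succ_of_ne_zero hi.ne'
      cases j <;> simp
    · refine .one_of_extend hgi hex hfs (hB.ext_dual 1 one_pos) fun φ => ?_
      -- A functional on `C^*` is evaluation at some `c`; evaluation at a preimage of `c` extends it
      -- to `B^*`.
      obtain ⟨c, rfl⟩ := hC.bijective_eval.2 φ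
      obtain ⟨b, rfl⟩ := hg c
      exact ⟨Module.Dual.eval R B b, by ext; simp⟩
    · exact .right hgi hex hfs (hC.ext_dual _ (by omega)) (hB.ext_dual _ (by omega))
  · rw [injective_iff_map_eq_zero]
    intro a ha
    apply hf
    rw [map_zero]
    apply (injective_iff_map_eq_zero _).1 hB.bijective_eval.1
    ext φ
    exact LinearMap.congr_fun ha (f.dualMap φ)
  · intro Φ
    obtain ⟨b, hb⟩ := hB.bijective_eval.2 (Φ ∘ₗ f.dualMap)
    have : g b = 0 := by
      apply (injective_iff_map_eq_zero _).1 hC.bijective_eval.1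
      ext φ
      have := LinearMap.congr_fun hb (g.dualMap φ)
      simpa [hex.apply_apply_eq_zero] using this
    obtain ⟨a, rfl⟩ := (h b).1 this
    refine ⟨a, ?_⟩
    ext φ
    obtain ⟨ψ, rfl⟩ := hfs φ
    simpa using LinearMap.congr_fun hb ψ

/-- The cokernel of an injection of totally reflexive modules is totally reflexive as soon as
functionals extend along it. -/
theorem IsTotRefl.right {f : A →ₗ[R] B} {g : B →ₗ[R] C} (hf : Function.Injective f)
    (h : Function.Exact f g) (hg : Function.Surjective g) (hA : IsTotRefl R A)
    (hB : IsTotRefl R B) (hfs : Function.Surjective f.dualMap) : IsTotRefl R C := by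
  have hgi : Function.Injective g.dualMap := LinearMap.dualMap_injective_of_surjective hg
  have hex := exact_dualMap h hg
  refine ⟨fun i hi => ?_, fun i hi => .left hgi hex hfs (hB.ext_dual i hi)
    (hA.ext_dual _ (by omega)), ?_, ?_⟩
  · obtain rfl | ⟨j, rfl⟩ : i = 1 ∨ ∃ j, i = j + 1 + 1 := by
      obtain ⟨j, rfl⟩ := Nat.exists_eq_succ_of_ne_zero hi.ne'
      cases j <;> simp
    · exact .one_of_extend hf h hg (hB.ext 1 one_pos) hfs
    · exact .right hf h hg (hA.ext _ (by omega)) (hB.ext _ (by omega))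
  · rw [injective_iff_map_eq_zero]
    intro c hc
    obtain ⟨b, rfl⟩ := hg c
    have h0 : Module.Dual.eval R B b ∘ₗ g.dualMap = 0 := by
      ext φ
      exact LinearMap.congr_fun hc φ
    obtain ⟨Φ, hΦ⟩ := exists_factor_of_exact hex hfs _ h0
    obtain ⟨a, rfl⟩ := hA.bijective_eval.2 Φ
    have : f a = b := by
      apply hB.bijective_eval.1
      rw [← hΦ]
      ext; simp
    rw [← this, h.apply_apply_eq_zero]
  · intro Φ
    obtain ⟨Ψ, rfl⟩ := ExtVanish.exists_extend hgi hex hfs (hA.ext_dual 1 one_pos) Φ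
    obtain ⟨b, rfl⟩ := hB.bijective_eval.2 Ψ
    exact ⟨g b, by ext; simp⟩

/-- `Ext^1(C, R) = 0` makes the dual sequence short exact; biduality for `B` then follows by the
chase of the five lemma. -/
theorem IsTotRefl.middle {f : A →ₗ[R] B} {g : B →ₗ[R] C} (hf : Function.Injective f)
    (h : Function.Exact f g) (hg : Function.Surjective g) (hA : IsTotRefl R A)
    (hC : IsTotRefl R C) : IsTotRefl R B := by
  have hfs : Function.Surjective f.dualMap := fun φ =>
    ExtVanish.exists_extend hf h hg (hC.ext 1 one_pos) φ
  have hgi : Function.Injective g.dualMap := LinearMap.dualMap_injective_of_surjective hg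
  have hex := exact_dualMap h hg
  refine ⟨fun i hi => .middle hf h hg (hA.ext i hi) (hC.ext i hi), fun i hi =>
    .middle hgi hex hfs (hC.ext_dual i hi) (hA.ext_dual i hi), ?_, ?_⟩
  · rw [injective_iff_map_eq_zero]
    intro b hb
    have : g b = 0 := by
      apply (injective_iff_map_eq_zero _).1 hC.bijective_eval.1
      ext φ
      exact LinearMap.congr_fun hb (g.dualMap φ)
    obtain ⟨a, rfl⟩ := (h b).1 this
    have : a = 0 := by
      apply (injective_iff_map_eq_zero _).1 hA.bijective_eval.1
      ext φ
      obtain ⟨ψ, rfl⟩ := hfs φ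
      exact LinearMap.congr_fun hb ψ
    rw [this, map_zero]
  · intro Φ
    obtain ⟨c, hc⟩ := hC.bijective_eval.2 (Φ ∘ₗ g.dualMap)
    obtain ⟨b, rfl⟩ := hg c
    obtain ⟨Ψ, hΨ⟩ := exists_factor_of_exact hex hfs (Φ - Module.Dual.eval R B b) (by
      rw [LinearMap.sub_comp, ← hc]; ext; simp)
    obtain ⟨a, rfl⟩ := hA.bijective_eval.2 Ψ
    refine ⟨f a + b, ?_⟩
    rw [map_add, ← eq_sub_iff_add_eq, ← hΨ]
    ext; simp

theorem IsTotRefl.of_subsingleton (M : Type u) [AddCommGroup M] [Module R M] [Subsingleton M] :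
    IsTotRefl R M :=
  haveI : Module.Free R M := .of_subsingleton R M
  .of_free M

theorem IsTotRefl.of_equiv (e : A ≃ₗ[R] B) (hB : IsTotRefl R B) : IsTotRefl R A :=
  .left (f := e.toLinearMap) (g := (0 : B →ₗ[R] PUnit.{u + 1})) e.injective
    (fun b => by simp) (fun _ => ⟨0, rfl⟩) hB (.of_subsingleton _)

end TotRefl

end CohGor

/-! ### G-dimension: syzygies and quotients -/

namespace CohGor

universe u

/-- `M` has a resolution of length at most `k` by totally reflexive modules. -/
def GDimLE (R : Type u) [CommRing R] :
    ℕ → ∀ (M : Type u) [AddCommGroup M] [Module R M], Prop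
  | 0, M, _, _ => IsTotRefl R M
  | k + 1, M, _, _ => ∃ (G : Type u) (_ : AddCommGroup G) (_ : Module R G) (g : G →ₗ[R] M),
      Function.Surjective g ∧ IsTotRefl R G ∧ GDimLE R k (LinearMap.ker g)

section GDimLE

variable {R : Type u} [CommRing R] {A B C : Type u} [AddCommGroup A] [Module R A]
  [AddCommGroup B] [Module R B] [AddCommGroup C] [Module R C]

theorem GDimLE.of_equiv {k : ℕ} (e : A ≃ₗ[R] B) (hB : GDimLE R k B) : GDimLE R k A := by
  cases k with
  | zero => exact IsTotRefl.of_equiv e hB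
  | succ k =>
    obtain ⟨G, _, _, g, hg, hG, hK⟩ := hB
    refine ⟨G, _, _, e.symm.toLinearMap ∘ₗ g, e.symm.surjective.comp hg, hG, ?_⟩
    rwa [LinearEquiv.ker_comp]

theorem equivKer {f : A →ₗ[R] B} {g : B →ₗ[R] C} (hf : Function.Injective f)
    (h : Function.Exact f g) : Nonempty (LinearMap.ker g ≃ₗ[R] A) :=
  ⟨(LinearEquiv.ofEq _ _ h.linearMap_ker_eq).trans (LinearEquiv.ofInjective f hf).symm⟩

theorem GDimLE.of_exact {k : ℕ} {f : A →ₗ[R] B} {g : B →ₗ[R] C} (hf : Function.Injective f)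
    (h : Function.Exact f g) (hg : Function.Surjective g) (hA : GDimLE R k A)
    (hB : IsTotRefl R B) : GDimLE R (k + 1) C :=
  ⟨B, _, _, g, hg, hB, hA.of_equiv (equivKer hf h).some⟩

theorem IsTotRefl.prod (hA : IsTotRefl R A) (hB : IsTotRefl R B) : IsTotRefl R (A × B) :=
  .middle LinearMap.inl_injective Function.Exact.inl_snd LinearMap.snd_surjective hA hB

theorem GDimLE.prod {k : ℕ} (hA : GDimLE R k A) (hB : IsTotRefl R B) : GDimLE R k (A × B) := by
  cases k with
  | zero => exact IsTotRefl.prod hA hB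
  | succ k =>
    obtain ⟨G, _, _, g, hg, hG, hK⟩ := hA
    refine .of_exact (f := LinearMap.inl R G B ∘ₗ (LinearMap.ker g).subtype)
      (g := g.prodMap LinearMap.id) (LinearMap.inl_injective.comp Subtype.val_injective) ?_
      (hg.prodMap Function.surjective_id) hK (hG.prod hB)
    rintro ⟨x, y⟩
    simp only [LinearMap.prodMap_apply, LinearMap.id_apply, Prod.mk_eq_zero]
    constructor
    · rintro ⟨hx, rfl⟩
      exact ⟨⟨x, hx⟩, rfl⟩
    · rintro ⟨⟨x, hx⟩, h⟩
      obtain ⟨rfl, rfl⟩ := Prod.mk.inj h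
      exact ⟨hx, rfl⟩

/-- If `G → B` begins a resolution of `B`, the kernel of `G → B → C` is totally reflexive and maps
onto `ker g` with the same kernel as `G → B`. -/
theorem GDimLE.ker {k : ℕ} {g : B →ₗ[R] C} (hg : Function.Surjective g) (hB : GDimLE R k B)
    (hC : IsTotRefl R C) : GDimLE R k (LinearMap.ker g) := by
  cases k with
  | zero =>
    exact IsTotRefl.left (f := (LinearMap.ker g).subtype) Subtype.val_injective
      (LinearMap.exact_subtype_ker_map g) hg hB hC
  | succ k =>
    obtain ⟨G, _, _, q, hq, hG, hK⟩ := hB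
    have hG' : IsTotRefl R (LinearMap.ker (g ∘ₗ q)) :=
      .left (f := (LinearMap.ker (g ∘ₗ q)).subtype) Subtype.val_injective
        (LinearMap.exact_subtype_ker_map _) (hg.comp hq) hG hC
    refine .of_exact (f := Submodule.inclusion (LinearMap.ker_le_ker_comp q g))
      (g := q.restrict (p := LinearMap.ker (g ∘ₗ q)) (q := LinearMap.ker g) fun x hx => hx)
      (Submodule.inclusion_injective _) ?_ ?_ hK hG'
    · rintro ⟨x, hx⟩
      constructor
      · intro h
        exact ⟨⟨x, congrArg Subtype.val h⟩, rfl⟩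
      · rintro ⟨y, hy⟩
        obtain rfl : y.1 = x := congrArg Subtype.val hy
        exact Subtype.ext y.2
    · rintro ⟨y, hy⟩
      obtain ⟨x, rfl⟩ := hq y
      exact ⟨⟨x, hy⟩, rfl⟩

/-- The first syzygy of a module with `G`-dimension at most `k + 1` has `G`-dimension at most
`k`. -/
theorem GDimLE.syzygy {k : ℕ} {f : A →ₗ[R] B} {p : B →ₗ[R] C} (hf : Function.Injective f)
    (h : Function.Exact f p) (hp : Function.Surjective p) [Module.Projective R B]
    (hB : IsTotRefl R B) (hC : GDimLE R (k + 1) C) : GDimLE R k A := by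
  obtain ⟨G, _, _, g, hg, hG, hK⟩ := hC
  obtain ⟨s, hs⟩ := Module.projective_lifting_property g p hg
  have hs' (x : B) : g (s x) = p x := LinearMap.congr_fun hs x
  -- Schanuel's argument: `(y, b) ↦ y + s b` is onto `G`, and its kernel consists of the pairs `(-s
  -- b, b)` with `p b = 0`, so it is a copy of `A`.
  let q : (LinearMap.ker g × B) →ₗ[R] G := (LinearMap.ker g).subtype.coprod s
  have hq : Function.Surjective q := by
    intro y
    obtain ⟨x, hx⟩ := hp (g y)
    exact ⟨(⟨y - s x, by simp [hs', hx]⟩, x), by simp [q]⟩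
  have hgf (a : A) : g (s (f a)) = 0 := by rw [hs', h.apply_apply_eq_zero]
  let j : A →ₗ[R] LinearMap.ker g × B := (-((s ∘ₗ f).codRestrict (LinearMap.ker g) hgf)).prod f
  refine .of_equiv (equivKer (f := j) (g := q) (fun a b hab => hf (congrArg Prod.snd hab)) ?_).some.symm
    ((hK.prod hB).ker hq hG)
  rintro ⟨⟨y, hy⟩, x⟩
  constructor
  · intro hxy
    have hxy : y + s x = 0 := hxy
    have : p x = 0 := by
      rw [← hs', eq_neg_of_add_eq_zero_right hxy, map_neg, LinearMap.mem_ker.1 hy, neg_zero]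
    obtain ⟨a, rfl⟩ := (h x).1 this
    refine ⟨a, Prod.ext (Subtype.ext ?_) rfl⟩
    exact (eq_neg_of_add_eq_zero_left hxy).symm
  · rintro ⟨a, ha⟩
    rw [← ha]
    exact neg_add_cancel _

/-- The quotient of a module with `G`-dimension at most `k + 1` by a finite free submodule has
`G`-dimension at most `k + 1`. -/
theorem GDimLE.quotient {k : ℕ} {f : A →ₗ[R] B} {p : B →ₗ[R] C} (hf : Function.Injective f)
    (h : Function.Exact f p) (hp : Function.Surjective p) [Module.Projective R A]
    (hA : IsTotRefl R A) (hB : GDimLE R (k + 1) B) : GDimLE R (k + 1) C := by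
  obtain ⟨G, _, _, g, hg, hG, hK⟩ := hB
  obtain ⟨s, hs⟩ := Module.projective_lifting_property g f hg
  have hs' (x : A) : g (s x) = f x := LinearMap.congr_fun hs x
  -- After lifting `A` into `G`, `C` is the quotient of `G` by `ker g ⊕ A`; the sum is direct
  -- because `f` is injective.
  refine .of_exact (f := (LinearMap.ker g).subtype.coprod s) (g := p ∘ₗ g) ?_ ?_ (hp.comp hg)
    (hK.prod hA) hG
  · rw [injective_iff_map_eq_zero]
    rintro ⟨⟨y, hy⟩, x⟩ hxy
    have hxy : y + s x = 0 := hxy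
    have : x = 0 := by
      apply hf
      rw [← hs', eq_neg_of_add_eq_zero_right hxy, map_neg, LinearMap.mem_ker.1 hy, neg_zero,
        map_zero]
    subst this
    simpa using hxy
  · intro y
    constructor
    · intro hy
      obtain ⟨x, hx⟩ := (h (g y)).1 hy
      exact ⟨(⟨y - s x, by simp [hs', hx]⟩, x), by simp⟩
    · rintro ⟨⟨⟨z, hz⟩, x⟩, rfl⟩
      simp [hs', LinearMap.mem_ker.1 hz, h.apply_apply_eq_zero]

end GDimLE

/-! ### From G-resolutions of finite length to `GDimLE` -/

section Resolution

variable {R : Type u} [CommRing R] {M : Type u} [AddCommGroup M] [Module R M]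

/-- The resolution of the kernel of the augmentation obtained by truncation. -/
def GResolution.tail (P : GResolution R M) : GResolution R (LinearMap.ker P.aug) where
  G i := P.G (i + 1)
  d i := P.d (i + 1)
  aug := (P.d 0).codRestrict _ P.exact_zero.apply_apply_eq_zero
  isGClass i := P.isGClass (i + 1)
  aug_surjective := by
    rintro ⟨y, hy⟩
    obtain ⟨x, rfl⟩ := (P.exact_zero y).1 hy
    exact ⟨x, rfl⟩
  exact_zero := by
    intro x
    rw [← P.exact_succ 0 x]
    exact Subtype.ext_iff
  exact_succ i := P.exact_succ (i + 1)

theorem GResolution.gDimLE (P : GResolution R M) {k : ℕ}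
    (h : ∀ j, k < j → Subsingleton (P.G j)) : GDimLE R k M := by
  induction k generalizing M with
  | zero =>
    have : Subsingleton (P.G 1) := h 1 one_pos
    have hinj : Function.Injective P.aug := by
      rw [injective_iff_map_eq_zero]
      intro x hx
      obtain ⟨y, rfl⟩ := (P.exact_zero x).1 hx
      rw [Subsingleton.elim y 0, map_zero]
    exact .of_equiv (LinearEquiv.ofBijective P.aug ⟨hinj, P.aug_surjective⟩).symm
      (P.isGClass 0).isTotRefl
  | succ k ih =>
    exact ⟨_, _, _, P.aug, P.aug_surjective, (P.isGClass 0).isTotRefl,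
      ih P.tail fun j hj => h (j + 1) (by omega)⟩

theorem exists_gDimLE_of_gDim_lt_top (h : gDim R M < ⊤) : ∃ k, GDimLE R k M := by
  obtain ⟨P, hP⟩ := iInf_lt_iff.1 h
  obtain ⟨k, hk⟩ := ENat.ne_top_iff_exists.1 hP.ne
  refine ⟨k, P.gDimLE fun j hj => ?_⟩
  rw [← not_nontrivial_iff_subsingleton]
  intro hn
  have : (j : ℕ∞) ≤ P.length := le_iSup₂_of_le j hn le_rfl
  rw [← hk] at this
  exact absurd (Nat.cast_le.1 this) (by omega)

end Resolution

end CohGor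

/-! ### Finite presentation over coherent rings -/

namespace CohGor

universe u v

/-- Induction on the rank: the first coordinate maps `M` onto a finitely generated ideal, which is
finitely presented, so the kernel is finitely generated and embeds in a free module of smaller rank.
-/
theorem IsCoherentRing.finitePresentation_of_injective {R : Type u} [CommRing R]
    (hR : IsCoherentRing R) {n : ℕ} {M : Type v} [AddCommGroup M] [Module R M] [Module.Finite R M]
    (f : M →ₗ[R] (Fin n → R)) (hf : Function.Injective f) : Module.FinitePresentation R M := by
  induction n generalizing M with
  | zero =>
    have : Subsingleton M := hf.subsingleton
    have : Module.Free R M := .of_subsingleton R M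
    exact Module.finitePresentation_of_projective R M
  | succ n ih =>
    let c : M →ₗ[R] R := LinearMap.proj 0 ∘ₗ f
    have hfg : (LinearMap.range c).FG := Submodule.FG.of_finite
    have hI : Module.FinitePresentation R (LinearMap.range c) := hR (LinearMap.range c) hfg
    have hK : (LinearMap.ker c.rangeRestrict).FG :=
      Module.FinitePresentation.fg_ker _ c.surjective_rangeRestrict
    have : Module.Finite R (LinearMap.ker c.rangeRestrict) := .of_fg hK
    have : Module.FinitePresentation R (LinearMap.ker c.rangeRestrict) := by
      refine ih ((LinearMap.funLeft R R Fin.succ) ∘ₗ f ∘ₗ (LinearMap.ker c.rangeRestrict).subtype) ?_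
      rintro ⟨a, ha⟩ ⟨b, hb⟩ hab
      refine Subtype.ext (hf (funext fun i => ?_))
      have ha : f a 0 = 0 := congrArg Subtype.val ha
      have hb : f b 0 = 0 := congrArg Subtype.val hb
      refine Fin.cases (ha.trans hb.symm) (fun j => ?_) i
      exact congrFun hab j
    exact Module.finitePresentation_of_ker _ c.surjective_rangeRestrict

theorem IsCoherentRing.finitePresentation_of_injective_of_free {R : Type u} [CommRing R]
    (hR : IsCoherentRing R) {M : Type v} [AddCommGroup M] [Module R M] [Module.Finite R M]
    {F : Type*} [AddCommGroup F] [Module R F] [Module.Free R F] [Module.Finite R F]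
    (f : M →ₗ[R] F) (hf : Function.Injective f) : Module.FinitePresentation R M := by
  rcases subsingleton_or_nontrivial R with h | h
  · have := Module.subsingleton R M
    have : Module.Free R M := .of_subsingleton R M
    exact Module.finitePresentation_of_projective R M
  · exact hR.finitePresentation_of_injective ((Module.finBasis R F).equivFun.toLinearMap ∘ₗ f)
      ((Module.finBasis R F).equivFun.injective.comp hf)

/-- The dual of a finitely presented module over a coherent ring is finitely presented. -/
theorem IsCoherentRing.finitePresentation_dual {R : Type u} [CommRing R]
    (hR : IsCoherentRing R) (M : Type v) [AddCommGroup M] [Module R M]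
    [Module.FinitePresentation R M] : Module.FinitePresentation R (Module.Dual R M) := by
  obtain ⟨n, p, hp⟩ := Module.Finite.exists_fin' R M
  have hK : (LinearMap.ker p).FG := Module.FinitePresentation.fg_ker p hp
  have : Module.Finite R (LinearMap.ker p) := .of_fg hK
  obtain ⟨m, q, hq⟩ := Module.Finite.exists_fin' R (LinearMap.ker p)
  let d : (Fin m → R) →ₗ[R] (Fin n → R) := (LinearMap.ker p).subtype ∘ₗ q
  have hd : Function.Exact d p := by
    intro y
    constructor
    · intro hy
      obtain ⟨z, hz⟩ := hq ⟨y, hy⟩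
      exact ⟨z, congrArg Subtype.val hz⟩
    · rintro ⟨z, rfl⟩
      exact (q z).2
  have hpi : Function.Injective p.dualMap := LinearMap.dualMap_injective_of_surjective hp
  have hex : LinearMap.ker d.dualMap = LinearMap.range p.dualMap :=
    (exact_dualMap hd hp).linearMap_ker_eq
  -- `M^*` is the kernel of `d.dualMap`. The image of that map is a finitely generated submodule of
  -- a free module, hence finitely presented, so its kernel is finitely generated.
  have : Module.FinitePresentation R (LinearMap.range d.dualMap) :=
    hR.finitePresentation_of_injective_of_free (M := LinearMap.range d.dualMap)
      (LinearMap.range d.dualMap).subtype Subtype.val_injective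
  have hfg : (LinearMap.ker d.dualMap.rangeRestrict).FG :=
    Module.FinitePresentation.fg_ker (R := R) (M := Module.Dual R (Fin n → R))
      (N := LinearMap.range d.dualMap) d.dualMap.rangeRestrict d.dualMap.surjective_rangeRestrict
  rw [LinearMap.ker_rangeRestrict, hex] at hfg
  have : Module.Finite R (LinearMap.range p.dualMap) := .of_fg hfg
  have : Module.Finite R (Module.Dual R M) :=
    .equiv (LinearEquiv.ofInjective p.dualMap hpi).symm
  exact hR.finitePresentation_of_injective_of_free p.dualMap hpi

theorem finitePresentation_of_surjective_algebraMap {R S : Type*} [CommRing R] [CommRing S]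
    [Algebra R S] (hs : Function.Surjective (algebraMap R S)) (M : Type*) [AddCommGroup M]
    [Module R M] [Module S M] [IsScalarTower R S M] [Module.FinitePresentation R M] :
    Module.FinitePresentation S M := by
  have : Module.Finite S M := .of_restrictScalars_finite R S M
  obtain ⟨n, p, hp⟩ := Module.Finite.exists_fin' S M
  refine Module.finitePresentation_of_surjective p hp ?_
  let r : (Fin n → R) →ₗ[R] (Fin n → S) := (Algebra.linearMap R S).compLeft (Fin n)
  have hr : Function.Surjective r := hs.comp_left
  have hfg : (LinearMap.ker (p.restrictScalars R ∘ₗ r)).FG :=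
    Module.FinitePresentation.fg_ker _ (hp.comp hr)
  have : (LinearMap.ker (p.restrictScalars R)).FG := by
    have := hfg.map r
    rwa [LinearMap.ker_comp, Submodule.map_comap_eq_of_surjective hr] at this
  have : Module.Finite R (LinearMap.ker p) := .of_fg this
  have : Module.Finite S (LinearMap.ker p) := .of_restrictScalars_finite R S _
  exact Submodule.FG.of_finite

theorem fg_comap_of_surjective {R S : Type*} [CommRing R] [CommRing S] [Algebra R S]
    (hs : Function.Surjective (algebraMap R S)) (hk : (RingHom.ker (algebraMap R S)).FG)
    {I : Ideal S} (hI : I.FG) : (I.comap (algebraMap R S)).FG := by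
  refine Ideal.fg_of_fg_map_of_fg_inf_ker_of_surjective (f := algebraMap R S) ?_ ?_ hs
  · rwa [Ideal.map_comap_of_surjective _ hs]
  · rwa [inf_eq_right.2 (Ideal.ker_le_comap _)]

/-- The preimage `J` of `I` is finitely generated, hence finitely presented over `R`; dividing by
the finitely generated kernel keeps `I` finitely presented, first over `R` and then over `S`. -/
theorem IsCoherentRing.of_surjective {R : Type u} {S : Type v} [CommRing R] [CommRing S]
    [Algebra R S] (hR : IsCoherentRing R) (hs : Function.Surjective (algebraMap R S))
    (hk : (RingHom.ker (algebraMap R S)).FG) : IsCoherentRing S := by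
  intro I hI
  let J : Ideal R := I.comap (algebraMap R S)
  have hJ : J.FG := fg_comap_of_surjective hs hk hI
  have : Module.FinitePresentation R J := hR J hJ
  let q : J →ₗ[R] I := (Algebra.linearMap R S).restrict (p := J) (q := I.restrictScalars R)
    fun x hx => hx
  have hq : Function.Surjective q := by
    rintro ⟨y, hy⟩
    obtain ⟨x, rfl⟩ := hs y
    exact ⟨⟨x, hy⟩, rfl⟩
  have hkq : (LinearMap.ker q).FG := by
    have : Submodule.map J.subtype (LinearMap.ker q) = RingHom.ker (algebraMap R S) := by
      ext y
      constructor
      · rintro ⟨x, hx, rfl⟩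
        exact congrArg Subtype.val hx
      · intro hy
        have hy' : algebraMap R S y = 0 := hy
        exact ⟨⟨y, by simp [J, hy']⟩, Subtype.ext hy', rfl⟩
    rw [← this] at hk
    exact Submodule.fg_of_fg_map_injective J.subtype J.subtype_injective hk
  have : Module.FinitePresentation R I := Module.finitePresentation_of_surjective q hq hkq
  exact finitePresentation_of_surjective_algebraMap hs I

end CohGor

/-! ### Change of rings for `Ext` modulo a non-zero-divisor -/

namespace CohGor

universe u

/-- `S` is the quotient of `R` by the non-zero-divisor `x`. -/
structure IsQuotientByRegular (R S : Type u) [CommRing R] [CommRing S] [Algebra R S] (x : R) :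
    Prop where
  surjective : Function.Surjective (algebraMap R S)
  algebraMap_eq_zero_iff : ∀ r, algebraMap R S r = 0 ↔ x ∣ r
  isRegular : ∀ r, x * r = 0 → r = 0

namespace IsQuotientByRegular

variable {R S : Type u} [CommRing R] [CommRing S] [Algebra R S] {x : R}

theorem algebraMap_self (h : IsQuotientByRegular R S x) : algebraMap R S x = 0 :=
  (h.algebraMap_eq_zero_iff x).2 dvd_rfl

theorem smul_eq_zero (h : IsQuotientByRegular R S x) {M : Type u} [AddCommGroup M] [Module R M]
    [Module S M] [IsScalarTower R S M] (m : M) : x • m = 0 := by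
  rw [← algebraMap_smul S, h.algebraMap_self, zero_smul]

theorem mul_left_cancel (h : IsQuotientByRegular R S x) {a b : R} (hab : x * a = x * b) : a = b :=
  sub_eq_zero.1 (h.isRegular _ (by rw [mul_sub, hab, sub_self]))

/-- Functionals with values divisible by `x` can be divided by `x`. -/
theorem exists_div (h : IsQuotientByRegular R S x) {A : Type u} [AddCommGroup A] [Module R A]
    (θ : A →ₗ[R] R) (hθ : ∀ a, x ∣ θ a) : ∃ θ' : A →ₗ[R] R, ∀ a, θ a = x * θ' a := by
  choose t ht using hθ
  refine ⟨{ toFun := t, map_add' := fun a b => ?_, map_smul' := fun r a => ?_ }, ht⟩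
  · apply h.mul_left_cancel
    rw [← ht, map_add, mul_add, ← ht, ← ht]
  · apply h.mul_left_cancel
    rw [← ht, map_smul, RingHom.id_apply, smul_eq_mul, smul_eq_mul, mul_left_comm, ← ht]

/-- Linear maps `N → R/x` lift to `R` if `Ext^1(N, R) = 0`. -/
theorem exists_lift (h : IsQuotientByRegular R S x) {N : Type u} [AddCommGroup N] [Module R N]
    (hN : ExtVanish R 1 N) (φ : N →ₗ[R] S) :
    ∃ ψ : N →ₗ[R] R, ∀ n, algebraMap R S (ψ n) = φ n := by
  let π : (N →₀ R) →ₗ[R] N := Finsupp.linearCombination R id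
  have hπ : Function.Surjective π := Finsupp.linearCombination_id_surjective R N
  obtain ⟨θ, hθ⟩ := Module.projective_lifting_property (Algebra.linearMap R S) (φ ∘ₗ π)
    h.surjective
  have hθ' (a) : algebraMap R S (θ a) = φ (π a) := LinearMap.congr_fun hθ a
  obtain ⟨k, hk⟩ := h.exists_div (θ ∘ₗ (LinearMap.ker π).subtype) fun (a : LinearMap.ker π) => by
    rw [← h.algebraMap_eq_zero_iff]
    change algebraMap R S (θ a.1) = 0
    rw [hθ', LinearMap.mem_ker.1 a.2, map_zero]
  have hex := LinearMap.exact_subtype_ker_map π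
  obtain ⟨k', rfl⟩ := ExtVanish.exists_extend (A := LinearMap.ker π) Subtype.val_injective hex hπ hN k
  -- On `ker π`, `θ` equals `x` times `k'`, so the corrected map descends to `N`; modulo `x` the
  -- correction is invisible.
  obtain ⟨ψ, hψ⟩ := exists_factor_of_surjective hπ (θ - x • k') fun a ha => by
    simpa [sub_eq_zero] using hk ⟨a, ha⟩
  refine ⟨ψ, fun n => ?_⟩
  obtain ⟨a, rfl⟩ := hπ n
  have : ψ (π a) = θ a - x * k' a := LinearMap.congr_fun hψ a
  rw [this, map_sub, map_mul, h.algebraMap_self, zero_mul, sub_zero, hθ']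

section Cover

variable {M : Type u} [AddCommGroup M] [Module R M] [Module S M] [IsScalarTower R S M]
  {ι : Type u}

variable (R S ι) in
/-- Reduction of free modules. -/
noncomputable def reduce : (ι →₀ R) →ₗ[R] (ι →₀ S) :=
  Finsupp.mapRange.linearMap (Algebra.linearMap R S)

theorem reduce_surjective (h : IsQuotientByRegular R S x) :
    Function.Surjective (reduce R S ι) :=
  Finsupp.mapRange_surjective _ (map_zero _) h.surjective

theorem reduce_eq_zero_iff (h : IsQuotientByRegular R S x) (f : ι →₀ R) :
    reduce R S ι f = 0 ↔ ∃ f', x • f' = f := by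
  constructor
  · intro hf
    have hd (i : ι) : x ∣ f i := by
      rw [← h.algebraMap_eq_zero_iff]
      exact DFunLike.congr_fun hf i
    choose t ht using hd
    refine ⟨Finsupp.onFinset f.support t fun i hi => ?_, ?_⟩
    · rw [Finsupp.mem_support_iff, ht]
      exact fun h0 => hi (h.isRegular _ h0)
    · ext i
      exact (ht i).symm
  · rintro ⟨f', rfl⟩
    ext i
    simpa using h.smul_eq_zero _

variable (R) in
/-- The `R`-linear cover of `M` by a free module given by a family of elements. -/
noncomputable abbrev cover (v : ι → M) : (ι →₀ R) →ₗ[R] M := Finsupp.linearCombination R v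

theorem cover_reduce (v : ι → M) (f : ι →₀ R) : cover S v (reduce R S ι f) = cover R v f := by
  have : (cover S v).restrictScalars R ∘ₗ reduce R S ι = cover R v := by
    ext i
    simp [reduce]
  exact LinearMap.congr_fun this f

theorem cover_surjective (h : IsQuotientByRegular R S x) {v : ι → M}
    (hv : Function.Surjective (cover S v)) : Function.Surjective (cover R v) := by
  intro m
  obtain ⟨f, rfl⟩ := hv m
  obtain ⟨g, rfl⟩ := h.reduce_surjective f
  exact ⟨g, (cover_reduce v g).symm⟩

/-- Multiplication by `x` from the free cover to the syzygy. -/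
noncomputable def mulToSyzygy (h : IsQuotientByRegular R S x) (v : ι → M) :
    (ι →₀ R) →ₗ[R] LinearMap.ker (cover R v) :=
  (LinearMap.lsmul R (ι →₀ R) x).codRestrict _ fun f => by
    rw [LinearMap.mem_ker, LinearMap.lsmul_apply, map_smul, h.smul_eq_zero]

theorem smul_injective (h : IsQuotientByRegular R S x) {f g : ι →₀ R} (hfg : x • f = x • g) :
    f = g := by
  ext i
  exact h.mul_left_cancel (DFunLike.congr_fun hfg i)

theorem mulToSyzygy_injective (h : IsQuotientByRegular R S x) (v : ι → M) :
    Function.Injective (h.mulToSyzygy v) := fun _ _ hfg =>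
  h.smul_injective (congrArg Subtype.val hfg)

variable (S) in
/-- The map from the `R`-syzygy to the `S`-syzygy. -/
noncomputable def reduceSyzygy (v : ι → M) :
    LinearMap.ker (cover R v) →ₗ[R] LinearMap.ker (cover S v) :=
  (reduce R S ι).restrict (p := LinearMap.ker (cover R v))
    (q := (LinearMap.ker (cover S v)).restrictScalars R) fun f hf => by
      change cover S v _ = 0
      rw [cover_reduce]
      exact hf

theorem reduceSyzygy_surjective (h : IsQuotientByRegular R S x) (v : ι → M) :
    Function.Surjective (reduceSyzygy (R := R) S v) := by
  rintro ⟨f, hf⟩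
  obtain ⟨g, rfl⟩ := h.reduce_surjective f
  exact ⟨⟨g, by rwa [LinearMap.mem_ker, cover_reduce] at hf⟩, rfl⟩

/-- With `F` the free cover over `R`, this compares the syzygies of `M` over the two rings: `x`
kills `M`, so `xF` lies in the `R`-syzygy, and `F/xF` is the free cover over `S`. -/
theorem exact_mulToSyzygy (h : IsQuotientByRegular R S x) (v : ι → M) :
    Function.Exact (h.mulToSyzygy v) (reduceSyzygy S v) := by
  intro f
  rw [Subtype.ext_iff]
  refine (h.reduce_eq_zero_iff f.1).trans ?_
  exact exists_congr fun f' => (Subtype.ext_iff (a1 := h.mulToSyzygy v f') (a2 := f)).symm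

theorem extVanish_syzygy (h : IsQuotientByRegular R S x) {v : ι → M}
    (hv : Function.Surjective (cover S v)) {i : ℕ} (hi : 0 < i) (hM : ExtVanish R (i + 1) M) :
    ExtVanish R i (LinearMap.ker (cover R v)) :=
  .left (f := (LinearMap.ker (cover R v)).subtype) Subtype.val_injective
    (LinearMap.exact_subtype_ker_map _) (h.cover_surjective hv) (.of_projective _ hi) hM

/-- Vanishing part of Rees' change of rings for `Ext`. -/
theorem extVanish (h : IsQuotientByRegular R S x) (hM : ∀ i, 2 ≤ i → ExtVanish R i M) :
    ∀ i, 0 < i → ExtVanish S i M := by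
  intro i hi
  induction i generalizing M with
  | zero => omega
  | succ i ih =>
    let v : M → M := id
    have hv : Function.Surjective (cover S v) := Finsupp.linearCombination_id_surjective S M
    have hΩ := LinearMap.exact_subtype_ker_map (cover S v)
    have hN (j : ℕ) (hj : 0 < j) : ExtVanish R j (LinearMap.ker (cover R v)) :=
      h.extVanish_syzygy hv hj (hM _ (by omega))
    rcases Nat.eq_zero_or_pos i with rfl | hi'
    · refine .one_of_extend (A := LinearMap.ker (cover S v)) (f := (LinearMap.ker (cover S v)).subtype)
        Subtype.val_injective hΩ hv
        (.of_projective _ hi) fun φ => ?_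
      -- Lift `φ` to `g` on the `R`-syzygy. As `φ` comes from the quotient by `xF`, `g (x f) = x *
      -- g' f` for some `g'` on all of `F`; this `g'` extends `g`, and its reduction extends `φ`.
      obtain ⟨g, hg⟩ := h.exists_lift (hN 1 one_pos)
        (φ.restrictScalars R ∘ₗ reduceSyzygy S v)
      obtain ⟨g', hg'⟩ := h.exists_div (g ∘ₗ h.mulToSyzygy v) fun f => by
        rw [← h.algebraMap_eq_zero_iff]
        change algebraMap R S (g (h.mulToSyzygy v f)) = 0
        rw [hg]
        change φ (reduceSyzygy S v _) = 0
        rw [(h.exact_mulToSyzygy v).apply_apply_eq_zero, map_zero]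
      have hg'' (f) : g (h.mulToSyzygy v f) = x * g' f := hg' f
      obtain ⟨ψ, hψ⟩ : ∃ ψ : (M →₀ S) →ₗ[R] S, ψ ∘ₗ reduce R S M = Algebra.linearMap R S ∘ₗ g' := by
        refine exists_factor_of_exact (f := LinearMap.lsmul R (M →₀ R) x)
          (fun f => h.reduce_eq_zero_iff f) h.reduce_surjective _ ?_
        refine LinearMap.ext fun f => ?_
        simp [h.algebraMap_self]
      refine ⟨ψ.extendScalarsOfSurjective h.surjective, LinearMap.ext fun y => ?_⟩
      obtain ⟨f, rfl⟩ := h.reduceSyzygy_surjective v y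
      have h1 : ψ (reduce R S M f.1) = algebraMap R S (g' f.1) := LinearMap.congr_fun hψ f.1
      have h2 : g' f.1 = g f := by
        apply h.mul_left_cancel
        rw [← hg'', ← smul_eq_mul, ← map_smul]
        rfl
      refine h1.trans ?_
      rw [h2, hg]
      rfl
    -- Dimension shift over `S`. The `S`-syzygy is the `R`-syzygy modulo a free module, so its `Ext`
    -- over `R` again vanishes from degree 2 on.
    · refine .right (A := LinearMap.ker (cover S v)) (f := (LinearMap.ker (cover S v)).subtype)
        Subtype.val_injective hΩ hv
        (ih (fun j hj => ?_) hi') (.of_projective _ hi)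
      obtain ⟨j, rfl⟩ := Nat.exists_eq_succ_of_ne_zero (by omega : j ≠ 0)
      exact .right (h.mulToSyzygy_injective v) (h.exact_mulToSyzygy v)
        (h.reduceSyzygy_surjective v) (.of_projective _ (by omega)) (hN _ (by omega))

end Cover

end IsQuotientByRegular

end CohGor

/-! ### G-dimension modulo a non-zero-divisor, and over rings whose finitely generated proper ideals
have annihilators -/

namespace CohGor

universe u

namespace IsQuotientByRegular

variable {R S : Type u} [CommRing R] [CommRing S] [Algebra R S] {x : R}
  {M : Type u} [AddCommGroup M] [Module R M] [Module S M] [IsScalarTower R S M]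
  {ι : Type u}

variable (S) in
theorem exists_finite_cover (M : Type u) [AddCommGroup M] [Module S M] [Module.Finite S M] :
    ∃ (ι : Type u) (_ : Finite ι) (v : ι → M), Function.Surjective (cover S v) := by
  obtain ⟨s, hs⟩ := Module.Finite.fg_top (R := S) (M := M)
  refine ⟨s, inferInstance, Subtype.val, ?_⟩
  rw [← LinearMap.range_eq_top, Finsupp.range_linearCombination, Subtype.range_coe_subtype]
  exact hs

/-- The `S`-dual of `M` is the cokernel of the `R`-dual of the inclusion of the syzygy. -/
theorem exists_connecting (h : IsQuotientByRegular R S x) {v : ι → M}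
    (hv : Function.Surjective (cover S v)) :
    ∃ δ : Module.Dual R (LinearMap.ker (cover R v)) →ₗ[R] Module.Dual S M,
      ∀ g f, δ g (cover R v f) = algebraMap R S (g (h.mulToSyzygy v f)) := by
  have hp := h.cover_surjective hv
  have (g : Module.Dual R (LinearMap.ker (cover R v))) : ∃ φ : M →ₗ[R] S,
      φ ∘ₗ cover R v = Algebra.linearMap R S ∘ₗ g ∘ₗ h.mulToSyzygy v := by
    refine exists_factor_of_surjective hp _ fun n hn => ?_
    change algebraMap R S (g (h.mulToSyzygy v n)) = 0
    have : h.mulToSyzygy v n = x • ⟨n, hn⟩ := rfl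
    rw [this, map_smul, smul_eq_mul, map_mul, h.algebraMap_self, zero_mul]
  choose δ hδ using this
  have hδ' (g f) : δ g (cover R v f) = algebraMap R S (g (h.mulToSyzygy v f)) :=
    LinearMap.congr_fun (hδ g) f
  refine ⟨{ toFun := fun g => (δ g).extendScalarsOfSurjective h.surjective
            map_add' := fun a b => ?_
            map_smul' := fun r a => ?_ }, hδ'⟩
  · refine LinearMap.ext fun m => ?_
    obtain ⟨f, rfl⟩ := hp m
    change δ (a + b) _ = δ a _ + δ b _
    simp [hδ']
  · refine LinearMap.ext fun m => ?_
    obtain ⟨f, rfl⟩ := hp m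
    change δ (r • a) _ = r • δ a _
    simp [hδ', Algebra.smul_def]

/-- The `R`-syzygy `N` is totally reflexive, and `0 → F^* → N^* → Hom_S(M, S) → 0` is exact. Thus
`M` and its `S`-dual both have `Ext` over `R` vanishing from degree 2 on, and Rees' theorem applies
to both. Biduality over `S` is deduced from `N ≅ N^**`. -/
theorem isTotRefl (h : IsQuotientByRegular R S x) [Module.Finite S M] (hM : GDimLE R 1 M) :
    IsTotRefl S M := by
  obtain ⟨ι, _, v, hv⟩ := exists_finite_cover S M
  have hp := h.cover_surjective hv
  have hker := LinearMap.exact_subtype_ker_map (cover R v)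
  have hN : IsTotRefl R (LinearMap.ker (cover R v)) :=
    GDimLE.syzygy (k := 0) Subtype.val_injective hker hp (.of_free _) hM
  obtain ⟨δ, hδ⟩ := h.exists_connecting hv
  have hx (g : Module.Dual R (LinearMap.ker (cover R v))) (n : LinearMap.ker (cover R v)) :
      g (h.mulToSyzygy v n) = x * g n := by
    rw [← smul_eq_mul, ← map_smul]
    rfl
  let res := (LinearMap.ker (cover R v)).subtype.dualMap
  have hres (θ f) : res θ (h.mulToSyzygy v f) = x * θ f := by
    rw [← smul_eq_mul, ← map_smul]
    rfl
  have hinj : Function.Injective res := by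
    rw [injective_iff_map_eq_zero]
    intro θ hθ
    refine LinearMap.ext fun f => h.isRegular _ ?_
    rw [← hres, hθ, LinearMap.zero_apply]
  have hsurj : Function.Surjective δ := by
    intro φ
    obtain ⟨θ, hθ⟩ := Module.projective_lifting_property (Algebra.linearMap R S)
      (φ.restrictScalars R ∘ₗ cover R v) h.surjective
    have hθ' (f) : algebraMap R S (θ f) = φ (cover R v f) := LinearMap.congr_fun hθ f
    obtain ⟨g, hg⟩ := h.exists_div (res θ) fun (n : LinearMap.ker (cover R v)) => by
      rw [← h.algebraMap_eq_zero_iff]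
      refine (hθ' n.1).trans ?_
      rw [LinearMap.mem_ker.1 n.2, map_zero]
    refine ⟨g, LinearMap.ext fun m => ?_⟩
    obtain ⟨f, rfl⟩ := hp m
    rw [hδ, ← hθ']
    congr 1
    apply h.mul_left_cancel
    rw [← hg, hres]
  have hex : Function.Exact res δ := by
    intro g
    constructor
    · intro hg
      obtain ⟨θ, hθ⟩ := h.exists_div (g ∘ₗ h.mulToSyzygy v) fun f => by
        rw [← h.algebraMap_eq_zero_iff]
        change algebraMap R S (g (h.mulToSyzygy v f)) = 0
        rw [← hδ, hg, LinearMap.zero_apply]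
      refine ⟨θ, LinearMap.ext fun n => h.mul_left_cancel ?_⟩
      exact (hθ n).symm.trans (hx g n)
    · rintro ⟨θ, rfl⟩
      refine LinearMap.ext fun m => ?_
      obtain ⟨f, rfl⟩ := hp m
      rw [hδ, hres, map_mul, h.algebraMap_self, zero_mul, LinearMap.zero_apply]
  refine ⟨h.extVanish fun i hi => ?_, h.extVanish fun i hi => ?_, ?_, ?_⟩
  · obtain ⟨i, rfl⟩ := Nat.exists_eq_succ_of_ne_zero (by omega : i ≠ 0)
    exact .right Subtype.val_injective hker hp (hN.ext i (by omega)) (.of_projective _ (by omega))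
  · obtain ⟨i, rfl⟩ := Nat.exists_eq_succ_of_ne_zero (by omega : i ≠ 0)
    exact .right hinj hex hsurj (.of_projective _ (by omega)) (hN.ext_dual _ (by omega))
  · rw [injective_iff_map_eq_zero]
    intro m hm
    obtain ⟨f, rfl⟩ := hp m
    -- Evaluation at `x f` has values divisible by `x`. The quotient is evaluation at some `n` in
    -- `N`, so `x f = x n` and `f = n` maps to zero in `M`.
    obtain ⟨Ψ, hΨ⟩ := h.exists_div (Module.Dual.eval R _ (h.mulToSyzygy v f)) fun g => by
      rw [← h.algebraMap_eq_zero_iff]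
      exact (hδ g f).symm.trans (LinearMap.congr_fun hm (δ g))
    obtain ⟨n, rfl⟩ := hN.bijective_eval.2 Ψ
    have : h.mulToSyzygy v f = h.mulToSyzygy v n := by
      apply hN.bijective_eval.1
      refine LinearMap.ext fun g => ?_
      exact (hΨ g).trans (hx g n).symm
    rw [h.mulToSyzygy_injective v this]
    exact n.2
  · intro Φ
    obtain ⟨Ψ, hΨ⟩ := h.exists_lift (hN.ext_dual 1 one_pos) (Φ.restrictScalars R ∘ₗ δ)
    obtain ⟨n, rfl⟩ := hN.bijective_eval.2 Ψ
    -- `δ` kills functionals restricted from `F`, so each coordinate of `n` is divisible by `x`; the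
    -- image of `n / x` in `M` represents `Φ`.
    obtain ⟨f, hf⟩ := (h.reduce_eq_zero_iff n.1).1 (by
      ext i
      refine (hΨ (res (Finsupp.lapply i))).trans ?_
      change Φ (δ (res _)) = 0
      rw [hex.apply_apply_eq_zero, map_zero])
    have hn : h.mulToSyzygy v f = n := Subtype.ext hf
    refine ⟨cover R v f, LinearMap.ext fun φ => ?_⟩
    obtain ⟨g, rfl⟩ := hsurj φ
    refine (hδ g f).trans ?_
    rw [hn]
    exact hΨ g

/-- Passing to the quotient by a regular element lowers the `G`-dimension by one. -/
theorem gDimLE (h : IsQuotientByRegular R S x) (hS : IsCoherentRing S)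
    [Module.FinitePresentation S M] {k : ℕ} (hM : GDimLE R (k + 1) M) : GDimLE S k M := by
  induction k generalizing M with
  | zero => exact h.isTotRefl hM
  | succ k ih =>
    obtain ⟨ι, _, v, hv⟩ := exists_finite_cover S M
    have hN : GDimLE R (k + 1) (LinearMap.ker (cover R v)) :=
      .syzygy Subtype.val_injective (LinearMap.exact_subtype_ker_map (cover R v))
        (h.cover_surjective hv) (.of_free _) hM
    -- Dividing the `R`-syzygy by a free submodule does not raise a bound that is already at least
    -- 1.
    have hΩ : GDimLE R (k + 1) (LinearMap.ker (cover S v)) :=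
      hN.quotient (h.mulToSyzygy_injective v) (h.exact_mulToSyzygy v)
        (h.reduceSyzygy_surjective v) (.of_free _)
    have : Module.Finite S (LinearMap.ker (cover S v)) :=
      .of_fg (Module.FinitePresentation.fg_ker _ hv)
    have : Module.FinitePresentation S (LinearMap.ker (cover S v)) :=
      hS.finitePresentation_of_injective_of_free (M := LinearMap.ker (cover S v))
        (LinearMap.ker (cover S v)).subtype Subtype.val_injective
    exact ⟨_, _, _, cover S v, hv, .of_free _, ih hΩ⟩

end IsQuotientByRegular

/-- Over a ring in which finitely generated proper ideals have nonzero annihilators, a finitely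
presented module with zero dual is zero. -/
theorem subsingleton_of_subsingleton_dual {R : Type u} [CommRing R]
    (hR : ∀ I : Ideal R, I.FG → I ≠ ⊤ → ∃ z : R, z ≠ 0 ∧ ∀ y ∈ I, z * y = 0)
    (E : Type u) [AddCommGroup E] [Module R E] [Module.FinitePresentation R E]
    [Subsingleton (Module.Dual R E)] : Subsingleton E := by
  obtain ⟨n, e, he⟩ := Module.Finite.exists_fin (R := R) (M := E)
  induction n generalizing E with
  | zero =>
    rw [Set.range_eq_empty, Submodule.span_empty] at he
    exact (Submodule.subsingleton_iff R).1 (subsingleton_of_bot_eq_top he)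
  | succ n ih =>
    let K : Submodule R E := Submodule.span R {e 0}
    have : Module.FinitePresentation R (E ⧸ K) :=
      Module.finitePresentation_of_surjective K.mkQ K.mkQ_surjective (by
        rw [Submodule.ker_mkQ]
        exact Submodule.fg_span_singleton _)
    have : Subsingleton (Module.Dual R (E ⧸ K)) :=
      (LinearMap.dualMap_injective_of_surjective K.mkQ_surjective).subsingleton
    have hQ : Subsingleton (E ⧸ K) := by
      refine ih (E ⧸ K) (K.mkQ ∘ e ∘ Fin.succ) ?_
      rw [Set.range_comp, ← Submodule.map_span, eq_top_iff, ← K.range_mkQ, ← Submodule.map_top,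
        ← he, Submodule.map_span, Submodule.map_span, Submodule.span_le]
      rintro _ ⟨_, ⟨i, rfl⟩, rfl⟩
      refine Fin.cases ?_ (fun j => ?_) i
      · have : K.mkQ (e 0) = 0 := by
          simp [K]
        rw [this]
        exact zero_mem _
      · exact Submodule.subset_span ⟨_, ⟨j, rfl⟩, rfl⟩
    have hK : K = ⊤ := Submodule.Quotient.subsingleton_iff.1 hQ
    let t := LinearMap.toSpanSingleton R E (e 0)
    have ht : Function.Surjective t := by
      rw [← LinearMap.range_eq_top, LinearMap.range_toSpanSingleton]
      exact hK
    have hI : (LinearMap.ker t).FG := Module.FinitePresentation.fg_ker t ht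
    by_cases hI' : LinearMap.ker t = ⊤
    · refine subsingleton_of_forall_eq 0 fun y => ?_
      obtain ⟨r, rfl⟩ := ht y
      rw [LinearMap.ker_eq_top.1 hI', LinearMap.zero_apply]
    -- Here `E` is cyclic, isomorphic to `R/I` with `I = ker t` proper, and `1 ↦ z` defines a
    -- nonzero functional.
    · obtain ⟨z, hz, hzI⟩ := hR (LinearMap.ker t) hI hI'
      obtain ⟨ψ, hψ⟩ := exists_factor_of_surjective ht (LinearMap.lsmul R R z) hzI
      refine absurd ?_ hz
      have := LinearMap.congr_fun hψ 1
      rw [Subsingleton.elim ψ 0] at this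
      simpa using this.symm

/-- Over a coherent ring in which finitely generated proper ideals have nonzero annihilators,
finitely presented modules of finite `G`-dimension are totally reflexive. -/
theorem GDimLE.isTotRefl {R : Type u} [CommRing R] (hcoh : IsCoherentRing R)
    (hR : ∀ I : Ideal R, I.FG → I ≠ ⊤ → ∃ z : R, z ≠ 0 ∧ ∀ y ∈ I, z * y = 0)
    {k : ℕ} {M : Type u} [AddCommGroup M] [Module R M] [Module.FinitePresentation R M]
    (hM : GDimLE R k M) : IsTotRefl R M := by
  induction k generalizing M with
  | zero => exact hM
  | succ k ih =>
    obtain ⟨n, p, hp⟩ := Module.Finite.exists_fin' R M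
    have hex := LinearMap.exact_subtype_ker_map p
    have : Module.Finite R (LinearMap.ker p) := .of_fg (Module.FinitePresentation.fg_ker p hp)
    have : Module.FinitePresentation R (LinearMap.ker p) :=
      hcoh.finitePresentation_of_injective (LinearMap.ker p).subtype Subtype.val_injective
    have hN : IsTotRefl R (LinearMap.ker p) :=
      ih (.syzygy (f := (LinearMap.ker p).subtype) Subtype.val_injective hex hp (.of_free _) hM)
    refine .right (f := (LinearMap.ker p).subtype) Subtype.val_injective hex hp hN (.of_free _) ?_
    let res := (LinearMap.ker p).subtype.dualMap
    have := hcoh.finitePresentation_dual (LinearMap.ker p)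
    -- This cokernel is `Ext^1(M, R)`, the obstruction to extending functionals from the syzygy; it
    -- vanishes as soon as its dual does.
    have : Module.FinitePresentation R (Module.Dual R (LinearMap.ker p) ⧸ LinearMap.range res) :=
      Module.finitePresentation_of_surjective _ (LinearMap.range res).mkQ_surjective (by
        rw [Submodule.ker_mkQ]
        exact Submodule.FG.of_finite)
    have : Subsingleton
        (Module.Dual R (Module.Dual R (LinearMap.ker p) ⧸ LinearMap.range res)) := by
      refine subsingleton_of_forall_eq 0 fun ψ => ?_
      -- By reflexivity a functional on the cokernel is evaluation at some `a` in the syzygy; it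
      -- kills the restricted coordinate functions, so `a = 0`.
      obtain ⟨⟨a, ha⟩, hv⟩ := hN.bijective_eval.2 (ψ ∘ₗ (LinearMap.range res).mkQ)
      have : a = 0 := by
        funext i
        refine (LinearMap.congr_fun hv (res (LinearMap.proj i))).trans ?_
        have : (LinearMap.range res).mkQ (res (LinearMap.proj i)) = 0 := by simp
        rw [LinearMap.comp_apply, this, map_zero]
        rfl
      subst this
      refine Submodule.linearMap_qext _ ?_
      rw [← hv]
      ext φ
      exact map_zero φ
    have := subsingleton_of_subsingleton_dual hR
      (Module.Dual R (LinearMap.ker p) ⧸ LinearMap.range res)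
    exact LinearMap.range_eq_top.1 (Submodule.Quotient.subsingleton_iff.1 this)

end CohGor

/-! ### Irreducibility, and maximal regular sequences -/

namespace CohGor

open RingTheory.Sequence Polynomial

universe u

theorem GDimLE.succ {R : Type u} [CommRing R] {k : ℕ} {M : Type u} [AddCommGroup M] [Module R M]
    (hM : GDimLE R k M) : GDimLE R (k + 1) M := by
  induction k generalizing M with
  | zero =>
    exact .of_exact (A := PUnit.{u + 1}) (f := 0) (g := LinearMap.id)
      (Function.injective_of_subsingleton _) (fun b => by simp [eq_comm]) Function.surjective_id
      (IsTotRefl.of_subsingleton _ : GDimLE R 0 _) hM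
  | succ k ih =>
    obtain ⟨G, _, _, g, hg, hG, hK⟩ := hM
    exact ⟨G, _, _, g, hg, hG, ih hK⟩

theorem isQuotientByRegular_quotient {R : Type u} [CommRing R] {x : R} (hx : IsSMulRegular R x) :
    IsQuotientByRegular R (R ⧸ Ideal.span {x}) x where
  surjective := Ideal.Quotient.mk_surjective
  algebraMap_eq_zero_iff r := by
    rw [Ideal.Quotient.algebraMap_eq, Ideal.Quotient.eq_zero_iff_mem, Ideal.mem_span_singleton]
  isRegular r hr := hx (by simpa using hr)

/-- If all quotients by finitely generated ideals are totally reflexive and the ring is local, then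
the zero ideal is irreducible. -/
theorem infIrred_bot_of_isTotRefl {R : Type u} [CommRing R] [IsLocalRing R]
    (hR : ∀ I : Ideal R, I.FG → IsTotRefl R (R ⧸ I)) : InfIrred (⊥ : Ideal R) := by
  refine ⟨fun h => bot_ne_top (isMax_iff_eq_top.1 h), fun b c hbc => ?_⟩
  by_contra! hne
  obtain ⟨⟨a₁, ha₁, h₁⟩, ⟨a₂, ha₂, h₂⟩⟩ :=
    hne.imp (Submodule.exists_mem_ne_zero_of_ne_bot) (Submodule.exists_mem_ne_zero_of_ne_bot)
  -- Shrinking to principal ideals makes `J ⊔ K` finitely generated, so the hypothesis applies to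
  -- it.
  let J := Ideal.span {a₁}
  let K := Ideal.span {a₂}
  have hJK : Disjoint J K := by
    rw [disjoint_iff_inf_le, ← hbc]
    exact inf_le_inf ((Ideal.span_singleton_le_iff_mem _).2 ha₁)
      ((Ideal.span_singleton_le_iff_mem _).2 ha₂)
  have hfg : (J ⊔ K).FG := (Submodule.fg_span_singleton a₁).sup (Submodule.fg_span_singleton a₂)
  let f : (J × K) →ₗ[R] R := J.subtype.coprod K.subtype
  have hf : Function.Injective f := by
    rw [← LinearMap.ker_eq_bot, LinearMap.ker_coprod_of_disjoint_range _ _ (by simpa using hJK)]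
    simp
  have hex : Function.Exact f (J ⊔ K).mkQ := by
    rw [LinearMap.exact_iff, Submodule.ker_mkQ, LinearMap.range_coprod]
    simp
  obtain ⟨ψ, hψ⟩ := ExtVanish.exists_extend hf hex (Submodule.mkQ_surjective _)
    ((hR _ hfg).ext 1 one_pos) (J.subtype ∘ₗ LinearMap.fst R J K)
  have e₁ : ψ 1 * a₁ = a₁ := by
    have : ψ a₁ = a₁ := by
      simpa [f] using LinearMap.congr_fun hψ (⟨a₁, Ideal.mem_span_singleton_self a₁⟩, 0)
    rwa [mul_comm, ← smul_eq_mul, ← map_smul, smul_eq_mul, mul_one]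
  have e₂ : ψ 1 * a₂ = 0 := by
    have : ψ a₂ = 0 := by
      simpa [f] using LinearMap.congr_fun hψ (0, ⟨a₂, Ideal.mem_span_singleton_self a₂⟩)
    rwa [mul_comm, ← smul_eq_mul, ← map_smul, smul_eq_mul, mul_one]
  rcases IsLocalRing.isUnit_or_isUnit_one_sub_self (ψ 1) with hu | hu
  · exact h₂ ((hu.mul_right_eq_zero).1 e₂)
  · exact h₁ ((hu.mul_right_eq_zero).1 (by rw [sub_mul, one_mul, e₁, sub_self]))

theorem infIrred_of_infIrred_map {R S : Type*} [CommRing R] [CommRing S] {f : R →+* S}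
    (hf : Function.Surjective f) {L : Ideal R} (hL : RingHom.ker f ≤ L)
    (h : InfIrred (L.map f)) : InfIrred L := by
  have hcm {I : Ideal R} (hI : RingHom.ker f ≤ I) : (I.map f).comap f = I := by
    rw [Ideal.comap_map_of_surjective' f hf, sup_eq_left.2 hI]
  refine ⟨fun hmax => h.1 ?_, fun b c hbc => ?_⟩
  · rw [isMax_iff_eq_top.1 hmax, Ideal.map_top]
    exact isMax_top
  · have hb : RingHom.ker f ≤ b := hL.trans (hbc ▸ inf_le_left)
    have hc : RingHom.ker f ≤ c := hL.trans (hbc ▸ inf_le_right)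
    have : b.map f ⊓ c.map f = L.map f := by
      rw [← Ideal.map_comap_of_surjective f hf (b.map f ⊓ c.map f), Ideal.comap_inf, hcm hb,
        hcm hc, hbc]
    refine (h.2 this).imp (fun e => ?_) (fun e => ?_)
    · rw [← hcm hb, e, hcm hL]
    · rw [← hcm hc, e, hcm hL]

/-- The annihilator condition is stated modulo `Ideal.ofList xs` so that it passes unchanged to
`R/x`; the depth of the quotient ring is never needed. -/
theorem infIrred_ofList {R : Type u} [CommRing R] [IsLocalRing R] (hcoh : IsCoherentRing R)
    (hG : ∀ I : Ideal R, I.FG → ∃ k, GDimLE R (k + 1) (R ⧸ I)) (xs : List R)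
    (hreg : IsWeaklyRegular R xs) (htop : Ideal.ofList xs ≠ ⊤)
    (hann : ∀ I : Ideal R, I.FG → I ≠ ⊤ →
      ∃ z ∉ Ideal.ofList xs, ∀ y ∈ I, z * y ∈ Ideal.ofList xs) :
    InfIrred (Ideal.ofList xs) := by
  generalize hn : xs.length = n
  induction n generalizing R with
  | zero =>
    obtain rfl := List.length_eq_zero_iff.1 hn
    simp only [Ideal.ofList_nil, Submodule.mem_bot] at hann ⊢
    refine infIrred_bot_of_isTotRefl fun I hI => ?_
    obtain ⟨k, hk⟩ := hG I hI
    have : Module.FinitePresentation R (R ⧸ I) :=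
      Module.finitePresentation_of_surjective I.mkQ I.mkQ_surjective (by rwa [Submodule.ker_mkQ])
    exact hk.isTotRefl hcoh hann
  | succ n ih =>
    obtain ⟨x, ys, rfl⟩ := List.exists_cons_of_length_eq_add_one hn
    obtain ⟨hx, hys⟩ := (isWeaklyRegular_cons_iff R x ys).1 hreg
    let S := R ⧸ Ideal.span {x}
    have hq : IsQuotientByRegular R S x := isQuotientByRegular_quotient hx
    have hker : RingHom.ker (algebraMap R S) = Ideal.span {x} := Ideal.mk_ker
    have hxL : Ideal.span {x} ≤ Ideal.ofList (x :: ys) := by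
      rw [Ideal.ofList_cons]
      exact le_sup_left
    have hmap : Ideal.ofList (ys.map (algebraMap R S)) =
        (Ideal.ofList (x :: ys)).map (algebraMap R S) := by
      rw [Ideal.map_ofList, List.map_cons, Ideal.ofList_cons, hq.algebraMap_self]
      simp
    have hcomap : (Ideal.ofList (ys.map (algebraMap R S))).comap (algebraMap R S) =
        Ideal.ofList (x :: ys) := by
      rw [hmap, Ideal.comap_map_of_surjective' _ hq.surjective, hker, sup_eq_left.2 hxL]
    have htop' : Ideal.ofList (ys.map (algebraMap R S)) ≠ ⊤ := by
      intro h
      rw [h, Ideal.comap_top] at hcomap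
      exact htop hcomap.symm
    have : Nontrivial S := Ideal.Quotient.nontrivial_iff.2 fun h =>
      htop (top_le_iff.1 (h ▸ hxL))
    have : IsLocalRing S := .of_surjective' (algebraMap R S) hq.surjective
    have hkfg : (RingHom.ker (algebraMap R S)).FG := by
      rw [hker]
      exact Submodule.fg_span_singleton x
    have hcohS : IsCoherentRing S := hcoh.of_surjective hq.surjective hkfg
    have hcfg (I : Ideal S) (hI : I.FG) : (I.comap (algebraMap R S)).FG :=
      fg_comap_of_surjective hq.surjective hkfg hI
    refine infIrred_of_infIrred_map hq.surjective (hker.trans_le hxL) ?_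
    rw [← hmap]
    refine ih hcohS (fun I hI => ?_) _ ?_ htop' (fun I hI hI' => ?_) (by simpa using hn)
    · obtain ⟨k, hk⟩ := hG _ (hcfg I hI)
      let p : R →ₗ[R] S ⧸ I := I.mkQ.restrictScalars R ∘ₗ Algebra.linearMap R S
      have hp : Function.Surjective p := I.mkQ_surjective.comp hq.surjective
      have hpk : LinearMap.ker p = I.comap (algebraMap R S) := by
        ext r
        exact Submodule.Quotient.mk_eq_zero I
      have : Module.FinitePresentation S (S ⧸ I) :=
        Module.finitePresentation_of_surjective I.mkQ I.mkQ_surjective (by rwa [Submodule.ker_mkQ])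
      rw [← hpk] at hk
      -- The bound falls from `k + 1` to `k` over `S`; weakening it again restores the form needed
      -- for the next quotient.
      exact ⟨k, (hq.gDimLE hcohS (hk.of_equiv (p.quotKerEquivOfSurjective hp).symm)).succ⟩
    · rw [isWeaklyRegular_map_algebraMap_iff]
      refine (LinearEquiv.isWeaklyRegular_congr (Submodule.quotEquivOfEq _ _ ?_) ys).1 hys
      rw [← Submodule.ideal_span_singleton_smul, smul_eq_mul, Ideal.mul_top]
    · obtain ⟨z, hz, hzI⟩ := hann _ (hcfg I hI) (by rwa [Ne, Ideal.comap_eq_top_iff])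
      rw [← hcomap] at hz hzI
      refine ⟨algebraMap R S z, hz, fun y hy => ?_⟩
      obtain ⟨r, rfl⟩ := hq.surjective y
      rw [← map_mul]
      exact hzI r hy

/-- A ring of finite depth modulo a regular sequence of maximal length has the property that
finitely generated proper ideals have nonzero annihilators. -/
theorem exists_annihilator_of_depth {R : Type u} [CommRing R] [IsLocalRing R] {xs : List R}
    (hdepth : ringDepth R ≤ xs.length) (hreg : IsRegular R xs) {I : Ideal R} (hI : I.FG)
    (hI' : I ≠ ⊤) : ∃ z ∉ Ideal.ofList xs, ∀ y ∈ I, z * y ∈ Ideal.ofList xs := by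
  by_contra! H
  obtain ⟨m, c, hc⟩ := Submodule.fg_iff_exists_fin_generating_family.1 hI
  have hcI (i) : c i ∈ I := hc ▸ Submodule.subset_span ⟨i, rfl⟩
  have hIm : I ≤ IsLocalRing.maximalIdeal R := IsLocalRing.le_maximalIdeal hI'
  let f : R[X] := ∑ i : Fin m, monomial i (c i)
  have hfi (i : Fin m) : f.coeff i = c i := by
    simp [f, coeff_monomial, Fin.val_inj]
  have hfI (k : ℕ) : f.coeff k ∈ I := by
    rw [finsetSum_coeff]
    refine sum_mem fun i _ => ?_
    rw [coeff_monomial]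
    split_ifs
    · exact hcI i
    · exact zero_mem _
  let ys := xs.map (algebraMap R R[X])
  have hys : IsRegular R[X] ys := hreg.of_faithfullyFlat
  have hmap : Ideal.ofList ys = (Ideal.ofList xs).map C := (Ideal.map_ofList _ _).symm
  -- McCoy: a zero divisor in `(R/L)[X]` is killed by a nonzero constant. Such a constant would
  -- carry all coefficients of `f`, hence `I`, into `L`.
  have hnzd : f.map (Ideal.Quotient.mk (Ideal.ofList xs)) ∈ nonZeroDivisors _ := by
    refine Polynomial.mem_nonZeroDivisors_iff.2 fun a ha => ?_
    obtain ⟨z, rfl⟩ := Ideal.Quotient.mk_surjective a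
    by_contra hz
    rw [Ideal.Quotient.eq_zero_iff_mem] at hz
    obtain ⟨y, hy, hzy⟩ := H z hz
    refine hzy ?_
    have hle : I ≤ Submodule.comap (LinearMap.lsmul R R z) (Ideal.ofList xs) := by
      rw [← hc, Submodule.span_le]
      rintro _ ⟨i, rfl⟩
      have := congrArg (fun q => coeff q i) ha
      simp only [coeff_smul, coeff_map, coeff_zero, smul_eq_mul, ← map_mul,
        Ideal.Quotient.eq_zero_iff_mem, hfi] at this
      exact this
    exact hle hy
  have hxm (y) (hy : y ∈ xs) : y ∈ IsLocalRing.maximalIdeal R := by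
    have : Ideal.ofList xs ≠ ⊤ := fun h => hreg.top_ne_smul (by rw [h, Ideal.smul_top_eq_map]; simp)
    exact IsLocalRing.le_maximalIdeal this (Ideal.subset_span hy)
  have hmem : ∀ q ∈ ys ++ [f], q ∈ (IsLocalRing.maximalIdeal R).map (algebraMap R R[X]) := by
    intro q hq
    rcases List.mem_append.1 hq with hq | hq
    · obtain ⟨y, hy, rfl⟩ := List.mem_map.1 hq
      exact Ideal.mem_map_of_mem _ (hxm y hy)
    · rw [List.mem_singleton.1 hq]
      exact Ideal.mem_map_C_iff.2 fun k => hIm (hfI k)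
  have hR : IsRegular R[X] (ys ++ [f]) := by
    refine ⟨(isWeaklyRegular_append_iff _ _ _).2 ⟨hys.1, ?_⟩, ?_⟩
    · rw [isWeaklyRegular_singleton_iff, isSMulRegular_iff_right_eq_zero_of_smul]
      intro g hg
      obtain ⟨g, rfl⟩ := Submodule.Quotient.mk_surjective _ g
      rw [← Submodule.Quotient.mk_smul, Submodule.Quotient.mk_eq_zero, smul_eq_mul, smul_eq_mul,
        Ideal.mul_top, hmap] at hg
      rw [Submodule.Quotient.mk_eq_zero, smul_eq_mul, Ideal.mul_top, hmap]
      have hmk (q : R[X]) : q ∈ (Ideal.ofList xs).map C ↔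
          q.map (Ideal.Quotient.mk (Ideal.ofList xs)) = 0 := by
        rw [Ideal.mem_map_C_iff]
        simp [Polynomial.ext_iff, Ideal.Quotient.eq_zero_iff_mem]
      rw [hmk] at hg ⊢
      rw [Polynomial.map_mul] at hg
      exact (mul_left_mem_nonZeroDivisors_eq_zero_iff hnzd).1 hg
    · intro h
      rw [smul_eq_mul, Ideal.mul_top] at h
      have h1 : (1 : R[X]) ∈ (IsLocalRing.maximalIdeal R).map (C : R →+* R[X]) :=
        Ideal.span_le.2 hmem (h.le Submodule.mem_top)
      have := Ideal.mem_map_C_iff.1 h1 0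
      rw [coeff_one_zero] at this
      exact (Ideal.ne_top_iff_one _).1 (IsLocalRing.maximalIdeal.isMaximal R).ne_top this
  -- The depth is defined through `S ⊗ M`, so the sequence is moved along `R[X] ⊗ R ≅ R[X]`.
  have hR' : IsRegular (TensorProduct R R[X] R) (ys ++ [f]) :=
    ((TensorProduct.AlgebraTensorModule.rid R R[X] R[X]).isRegular_congr _).2 hR
  have hle : ((ys ++ [f]).length : ℕ∞) ≤ ringDepth R :=
    le_trans (b := classicalDepth _ (TensorProduct R R[X] R))
      (le_iSup₂_of_le (ys ++ [f]) hR' (le_iSup (fun _ => _) hmem))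
      (le_iSup₂_of_le R[X] inferInstance (le_iSup₂_of_le inferInstance inferInstance le_rfl))
  have := hle.trans hdepth
  rw [Nat.cast_le] at this
  simp [ys] at this

theorem IsGorensteinLocalRing.exists_gDimLE_quotient {R : Type u} [CommRing R] [IsLocalRing R]
    (hR : IsGorensteinLocalRing R) {I : Ideal R} (hI : I.FG) :
    ∃ k, GDimLE R (k + 1) (R ⧸ I) := by
  obtain ⟨k, hk⟩ := exists_gDimLE_of_gDim_lt_top (hR I hI)
  exact ⟨k, .of_exact (f := I.subtype) (g := I.mkQ) Subtype.val_injective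
    (LinearMap.exact_subtype_mkQ I) I.mkQ_surjective hk (.of_free R)⟩

end CohGor

theorem proposition5p17 {R : Type*} [CommRing R] [IsLocalRing R]
    (hcoh : CohGor.IsCoherentRing R) (hGor : CohGor.IsGorensteinLocalRing R)
    (n : ℕ) (hdepth : CohGor.ringDepth R = (n : ℕ∞))
    (xs : List R) (hlen : xs.length = n) (hreg : RingTheory.Sequence.IsRegular R xs) :
    InfIrred (Ideal.ofList xs) := by
  subst hlen
  exact CohGor.infIrred_ofList hcoh (fun _ hI => hGor.exists_gDimLE_quotient hI) xs hreg.1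
    (fun h => hreg.top_ne_smul (by rw [h, smul_eq_mul, Ideal.mul_top]))
    fun _ => CohGor.exists_annihilator_of_depth hdepth.le hreg
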